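/- Let $\mathcal H$ be a complex Hilbert space, let $A$ be a (possibly unbounded) selfadjoint operator in $\mathcal H$, let $B\neq 0$ be a bounded selfadjoint operator on $\mathcal H$, and let $c\ge 0$ and $d>0$ be real numbers. Consider $$T(\omega)=A-\omega^2-\frac{\omega^2}{c-id\omega-\omega^2}B ,$$ and for $\alpha,\beta\in\mathbb R$ put $$p_{(\alpha,\beta)}(\omega)=(\alpha-\omega^2)(c-id\omega-\omega^2)-\beta\omega^2 .$$ Let $\overline{\mathbb R}=\mathbb R\cup\{\pm\infty\}$ and let $\overline{\mathbb C}=\mathbb C\cup\{\infty\}$ be the Riemann sphere. For $\alpha=\pm\infty$ and $\beta\in\mathbb R$, the roots of $p_{(\alpha,\beta)}$ are understood as the limits in $\overline{\mathbb C}$ of the roots of $p_{(\alpha',\beta)}$ as $\alpha'\to\pm\infty$. For $X\subset\overline{\mathbb R}\times\mathbb R$ let $W_X(T)\subset\overline{\mathbb C}$ be the union over $(\alpha,\beta)\in X$ of the sets of roots of $p_{(\alpha,\beta)}$. Let $$W(A)=\Big\{\tfrac{(Au,u)}{(u,u)}:u\in\operatorname{dom}A\setminus\{0\}\Big\},\qquad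 W(B)=\Big\{\tfrac{(Bu,u)}{(u,u)}:u\in\mathcal H\setminus\{0\}\Big\}$$ be the numerical ranges of $A$ and $B$, and let $\Omega=\overline{W(A)}\times\overline{W(B)}$, where the closure of $W(A)$ is taken in $\overline{\mathbb R}$ and that of $W(B)$ in $\mathbb R$. Let $\partial\Omega$ be the boundary of $\Omega$ in $\overline{\mathbb R}\times\mathbb R$ and $\partial W_\Omega(T)$ the boundary of $W_\Omega(T)$ in $\overline{\mathbb C}$. Let $i\mathbb R\subset\mathbb C$ be the imaginary axis (so $\infty\notin i\mathbb R$). Then 1. $W_\Omega(T)\cap i\mathbb R=W_{\partial\Omega}(T)\cap i\mathbb R$; 2. $\partial W_\Omega(T)\setminus i\mathbb R=W_{\partial\Omega}(T)\setminus i\mathbb R$. -/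

import Mathlib

open Filter Topology

noncomputable section

namespace RationalEnclosure

/-- The numerical range `W(A)` of a densely defined operator `A` on a complex Hilbert space, as a
set of real numbers (for a selfadjoint operator all Rayleigh quotients are real).  Mathlib's inner
product is linear in the second variable, so `(Au, u)` is `inner ℂ u (A u)`. -/
def numRange {H : Type*} [NormedAddCommGroup H] [InnerProductSpace ℂ H]
    (A : H →ₗ.[ℂ] H) : Set ℝ :=
  {a | ∃ u : A.domain, u ≠ 0 ∧ inner ℂ (u : H) (A u) / inner ℂ (u : H) (u : H) = (a : ℂ)}

/-- The numerical range `W(B)` of a bounded operator `B`. -/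
def numRangeBdd {H : Type*} [NormedAddCommGroup H] [InnerProductSpace ℂ H]
    (B : H →L[ℂ] H) : Set ℝ :=
  {b | ∃ u : H, u ≠ 0 ∧ inner ℂ u (B u) / inner ℂ u u = (b : ℂ)}

/-- The set `Ω`: the closure of `W(A)` in the extended real line times the closure of `W(B)`. -/
def Omega {H : Type*} [NormedAddCommGroup H] [InnerProductSpace ℂ H]
    (A : H →ₗ.[ℂ] H) (B : H →L[ℂ] H) : Set (EReal × ℝ) :=
  closure ((fun a : ℝ => (a : EReal)) '' numRange A) ×ˢ closure (numRangeBdd B)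

/-- The polynomial `p_{(α,β)}(ω) = (α - ω²)(c - idω - ω²) - βω²`. -/
def p (c d α β : ℝ) (ω : ℂ) : ℂ :=
  ((α : ℂ) - ω ^ 2) * ((c : ℂ) - Complex.I * (d : ℂ) * ω - ω ^ 2) - (β : ℂ) * ω ^ 2

/-- The limit values, in the Riemann sphere, of the roots of `p_{(α,β)}` as `α` tends along `l`
with `β` fixed: the points `z` that are the limit of some choice `r α` of a root of `p_{(α,β)}`. -/
def limitRoots (c d : ℝ) (l : Filter ℝ) (β : ℝ) : Set (OnePoint ℂ) :=
  {z | ∃ r : ℝ → ℂ, (∀ᶠ α in l, p c d α β (r α) = 0) ∧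
    Tendsto (fun α => (r α : OnePoint ℂ)) l (𝓝 z)}

/-- The set `{r₁(α,β), …, r₄(α,β)}` of roots of `p_{(α,β)}` in the Riemann sphere, for `α` in the
extended real line.  For `α = ±∞` the roots are the limit values of the roots. -/
def rootSet (c d : ℝ) : EReal → ℝ → Set (OnePoint ℂ)
  | ⊥, β => limitRoots c d atBot β
  | ⊤, β => limitRoots c d atTop β
  | (α : ℝ), β => {z | ∃ ω : ℂ, p c d α β ω = 0 ∧ (ω : OnePoint ℂ) = z}

/-- The set `W_X(T)`, the union over `(α, β) ∈ X` of the roots of `p_{(α,β)}`. -/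
def W (c d : ℝ) (X : Set (EReal × ℝ)) : Set (OnePoint ℂ) :=
  ⋃ x ∈ X, rootSet c d x.1 x.2

/-- The imaginary axis `iℝ` as a subset of the Riemann sphere; it does not contain `∞`. -/
def imAxis : Set (OnePoint ℂ) :=
  (fun ω : ℂ => (ω : OnePoint ℂ)) '' {ω | ω.re = 0}

end RationalEnclosure

end

/-!
# The boundary of the enclosure `W_Ω(T)`

The set `Ω` enters the argument as a closed subset of `EReal × ℝ` that is bounded in the second
coordinate (by `‖B‖`).

Let `q(ω) = c - idω - ω²`, so that `p_{(α,β)}(ω) = (α - ω²) q(ω) - βω²`. As `α → ±∞`, two roots of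
`p_{(α,β)}` tend to the roots of `q` and the other two to `∞` (`mem_limitRoots_iff`); hence the
roots at `α = ±∞` do not depend on `β`. The graph of the root set is closed, and `Ω` is compact, so
`W_Ω(T)` is closed in the sphere (`isClosed_W`).

A finite `ω` off the imaginary axis gives two real linear equations for `(α, β)`, with determinant
proportional to `discr c d ω`. Off the circle `discr = 0` the pair `(α, β)` is a continuous function
of `ω`, so interior pairs give interior points (`coe_mem_interior_W`); by continuity of roots,
boundary pairs give boundary points (`coe_notMem_interior_W`). On the circle there are no solutions
except at the roots of `q`, which are therefore never interior points of `W_Ω(T)`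
(`coe_notMem_interior_W_of_q_eq_zero`). The point `∞` is not interior because `β` would be unbounded
along the ray `t (1 + i)` (`infty_notMem_interior_W`).

In the remaining cases, namely `ω` imaginary, `q(ω) = 0`, or `α = ±∞`, the pairs having a given root
contain a curve along which `Ω` can be left, because `β` is bounded on `Ω`. By connectedness that
curve meets the boundary of `Ω` (`mem_W_frontier_of_re_eq_zero`, `mem_W_frontier_of_q_eq_zero`,
`mem_W_frontier_of_infinite`). For `q(ω) = 0` and finite `α` the curve moves `α` alone, and it may
stay in `Ω` all the way to `α = +∞`, where `β` becomes free.
-/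

/-! ### Roots of monic polynomials with small values -/

open Polynomial in
/-- A monic polynomial whose value at `w` is small has a root close to `w`; the linear factor of
this root is split off so that the lemma can be applied again to the cofactor. -/
theorem Polynomial.Monic.exists_factor_norm_sub_pow_le {P : ℂ[X]} (hP : P.Monic) {n : ℕ}
    (hn : P.natDegree = n + 1) (w : ℂ) :
    ∃ (r : ℂ) (Q : ℂ[X]), Q.Monic ∧ Q.natDegree = n ∧ P = (X - C r) * Q ∧
      ‖w - r‖ ^ (n + 1) ≤ ‖P.eval w‖ := by
  have hs : P.Splits := IsAlgClosed.splits P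
  have hcard : P.roots.card = n + 1 := by rw [← hn, hs.natDegree_eq_card_roots]
  have hne : P.roots.toFinset.Nonempty := by
    obtain ⟨a, ha⟩ := Multiset.card_pos_iff_exists_mem.1 (by omega : 0 < P.roots.card)
    exact ⟨a, by simpa using ha⟩
  obtain ⟨r, hr, hmin⟩ := Finset.exists_min_image P.roots.toFinset (fun z => ‖w - z‖) hne
  have hr0 : P.IsRoot r := by
    have := (Multiset.mem_toFinset.1 hr)
    exact (mem_roots'.1 this).2
  obtain ⟨Q, hQ⟩ := dvd_iff_isRoot.2 hr0
  have hQm : Q.Monic := (monic_X_sub_C r).of_mul_monic_left (hQ ▸ hP)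
  refine ⟨r, Q, hQm, ?_, hQ, ?_⟩
  · have := (monic_X_sub_C r).natDegree_mul hQm
    rw [← hQ, natDegree_X_sub_C] at this
    omega
  · have hprod : ‖(P.roots.map fun z => w - z).prod‖ = (P.roots.map fun z => ‖w - z‖).prod :=
      (map_multiset_prod (normHom : ℂ →*₀ ℝ) _).trans (by rw [Multiset.map_map]; rfl)
    rw [hs.eval_eq_prod_roots_of_monic hP, hprod, ← hcard, ← Multiset.card_map (fun _ => ‖w - r‖) P.roots,
      ← Multiset.prod_replicate, Multiset.card_map, ← Multiset.map_const']
    refine Multiset.prod_map_le_prod_map₀ _ _ (fun _ _ => norm_nonneg _) fun z hz => ?_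
    exact hmin z (by simpa using hz)

namespace RationalEnclosure

variable {c d α β : ℝ} {ω : ℂ}

/-! ### The roots of `p_{(α,β)}` and their limits as `α → ±∞` -/

/-- The quadratic polynomial `c - idω - ω²`, the denominator of the rational term of `T(ω)`.  Its
roots are the finite roots of `p_{(α,β)}` for `α = ±∞`. -/
noncomputable def q (c d : ℝ) (ω : ℂ) : ℂ := (c : ℂ) - Complex.I * (d : ℂ) * ω - ω ^ 2

theorem p_eq (c d α β : ℝ) (ω : ℂ) :
    p c d α β ω = ((α : ℂ) - ω ^ 2) * q c d ω - (β : ℂ) * ω ^ 2 := rfl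

open Polynomial in
/-- `p_{(α,β)}` as a formal polynomial, expanded in powers of the variable. -/
noncomputable def pPoly (c d α β : ℝ) : ℂ[X] :=
  X ^ 4 + C (Complex.I * d) * X ^ 3 - C (α + c + β : ℂ) * X ^ 2 - C (Complex.I * d * α) * X
    + C (α * c : ℂ)

theorem eval_pPoly (c d α β : ℝ) (ω : ℂ) : (pPoly c d α β).eval ω = p c d α β ω := by
  simp [pPoly, p]; ring

theorem natDegree_pPoly (c d α β : ℝ) : (pPoly c d α β).natDegree = 4 := by
  unfold pPoly; compute_degree!

theorem monic_pPoly (c d α β : ℝ) : (pPoly c d α β).Monic := by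
  unfold pPoly; monicity!

theorem exists_root_norm_sub_pow_le (c d α β : ℝ) (w : ℂ) :
    ∃ r, p c d α β r = 0 ∧ ‖w - r‖ ^ 4 ≤ ‖p c d α β w‖ := by
  obtain ⟨r, Q, -, -, h, hle⟩ :=
    (monic_pPoly c d α β).exists_factor_norm_sub_pow_le (natDegree_pPoly c d α β) w
  refine ⟨r, ?_, by rwa [eval_pPoly] at hle⟩
  rw [← eval_pPoly, h]; simp

/-- The roots of `p_{(α,β)}` depend continuously on real `(α, β)`. -/
theorem eventually_exists_root_mem (h : p c d α β ω = 0) {N : Set ℂ} (hN : N ∈ 𝓝 ω) :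
    ∀ᶠ x : ℝ × ℝ in 𝓝 (α, β), ∃ z ∈ N, p c d x.1 x.2 z = 0 := by
  obtain ⟨ε, hε, hball⟩ := Metric.mem_nhds_iff.1 hN
  have hcont : Continuous fun x : ℝ × ℝ => ‖p c d x.1 x.2 ω‖ := by unfold p; fun_prop
  have hlim : Tendsto (fun x : ℝ × ℝ => ‖p c d x.1 x.2 ω‖) (𝓝 (α, β)) (𝓝 0) := by
    simpa [h] using hcont.tendsto (α, β)
  filter_upwards [hlim.eventually_lt_const (pow_pos hε 4)] with x hx
  obtain ⟨r, hr, hle⟩ := exists_root_norm_sub_pow_le c d x.1 x.2 ω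
  refine ⟨r, hball ?_, hr⟩
  rw [Metric.mem_ball, dist_comm, dist_eq_norm]
  exact lt_of_pow_lt_pow_left₀ 4 hε.le (hle.trans_lt hx)

/-- For `|α|` large, `p_{(α,β)}` has two roots of size comparable to `√|α|`, one near each square
root of `α`, and the values of the remaining quadratic factor `Q` are controlled by those of
`p_{(α,β)}`. -/
theorem exists_two_large_roots (c d : ℝ) (h : 16 * |β| ≤ |α|) (hα : α ≠ 0) :
    ∃ (r₁ r₂ : ℂ) (Q : Polynomial ℂ), Q.Monic ∧ Q.natDegree = 2 ∧
      (∀ z, p c d α β z = (z - r₁) * ((z - r₂) * Q.eval z)) ∧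
      |α| ≤ (2 * ‖r₁‖) ^ 2 ∧ |α| ≤ (2 * ‖r₂‖) ^ 2 := by
  obtain ⟨s, hs⟩ := IsAlgClosed.exists_pow_nat_eq (α : ℂ) (n := 2) (by norm_num)
  have hsn : ‖s‖ ^ 2 = |α| := by rw [← norm_pow, hs]; simp
  have hs0 : 0 < ‖s‖ := by
    refine norm_pos_iff.2 fun h0 => hα ?_
    simpa [h0] using hs.symm
  have hp : ∀ z : ℂ, z ^ 2 = α → ‖p c d α β z‖ = |β| * ‖s‖ ^ 2 := by
    intro z hz
    rw [p_eq, hz]; simp [hsn]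
  obtain ⟨r₁, Q₁, hQ₁, hd₁, hf₁, hle₁⟩ :=
    (monic_pPoly c d α β).exists_factor_norm_sub_pow_le (natDegree_pPoly c d α β) s
  obtain ⟨r₂, Q, hQ, hd₂, hf₂, hle₂⟩ := hQ₁.exists_factor_norm_sub_pow_le hd₁ (-s)
  have hf : ∀ z, p c d α β z = (z - r₁) * ((z - r₂) * Q.eval z) := by
    intro z
    rw [← eval_pPoly, hf₁, hf₂]; simp
  rw [eval_pPoly, hp s hs] at hle₁
  have h₁ : ‖s - r₁‖ ≤ ‖s‖ / 2 := by
    refine le_of_pow_le_pow_left₀ (n := 4) (by norm_num) (by positivity) (hle₁.trans ?_)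
    nlinarith [sq_nonneg ‖s‖]
  have h₁' : ‖s‖ ≤ ‖-s - r₁‖ := by
    have h1 : ‖(2 : ℂ) * s‖ = 2 * ‖s‖ := by simp
    have h2 := norm_sub_le (s - r₁) (-s - r₁)
    rw [show s - r₁ - (-s - r₁) = 2 * s by ring, h1] at h2
    linarith
  have h₂ : ‖-s - r₂‖ ≤ ‖s‖ / 2 := by
    have h3 : ‖-s - r₁‖ * ‖Q₁.eval (-s)‖ = |β| * ‖s‖ ^ 2 := by
      rw [← hp (-s) (by rw [neg_sq, hs]), ← norm_mul, ← eval_pPoly, hf₁]; simp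
    refine le_of_pow_le_pow_left₀ (n := 3) (by norm_num) (by positivity) (hle₂.trans ?_)
    refine le_of_mul_le_mul_left ?_ hs0
    have h4 : ‖s‖ * ‖Q₁.eval (-s)‖ ≤ |β| * ‖s‖ ^ 2 :=
      h3 ▸ mul_le_mul_of_nonneg_right h₁' (norm_nonneg _)
    nlinarith [sq_nonneg ‖s‖]
  have key : ∀ t r : ℂ, ‖t‖ = ‖s‖ → ‖t - r‖ ≤ ‖s‖ / 2 → |α| ≤ (2 * ‖r‖) ^ 2 := by
    intro t r ht hr
    have := norm_sub_norm_le t r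
    rw [← hsn]
    exact pow_le_pow_left₀ hs0.le (by linarith) 2
  exact ⟨r₁, r₂, Q, hQ, hd₂, hf, key s r₁ rfl h₁, key (-s) r₂ (norm_neg s) h₂⟩

/-- For `|α|` large, some root of `p_{(α,β)}` is within `O(|α|^{-1/2})` of a given root of `q`. -/
theorem exists_root_norm_sub_sq_mul_le (hω : q c d ω = 0) (h : 16 * |β| ≤ |α|)
    (hα : (4 * ‖ω‖) ^ 2 ≤ |α|) (hα0 : α ≠ 0) :
    ∃ r, p c d α β r = 0 ∧ ‖ω - r‖ ^ 2 * |α| ≤ 16 * (|β| * ‖ω‖ ^ 2) := by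
  obtain ⟨r₁, r₂, Q, hQ, hd, hf, h₁, h₂⟩ := exists_two_large_roots c d h hα0
  obtain ⟨r, Q', -, -, hQ', hle⟩ := hQ.exists_factor_norm_sub_pow_le hd ω
  refine ⟨r, by rw [hf, hQ']; simp, ?_⟩
  have key : ∀ x : ℂ, |α| ≤ (2 * ‖x‖) ^ 2 → √|α| / 4 ≤ ‖ω - x‖ := by
    intro x hx
    have h4 : 4 * ‖ω‖ ≤ √|α| := Real.le_sqrt_of_sq_le hα
    have h5 := norm_sub_norm_le x ω
    rw [norm_sub_rev] at h5
    have h6 : √|α| ≤ 2 * ‖x‖ := Real.sqrt_le_iff.2 ⟨by positivity, hx⟩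
    linarith
  have hp : ‖ω - r₁‖ * (‖ω - r₂‖ * ‖Q.eval ω‖) = |β| * ‖ω‖ ^ 2 := by
    rw [← norm_mul, ← norm_mul, ← hf, p_eq, hω]; simp
  have hα' : √|α| * √|α| = |α| := Real.mul_self_sqrt (abs_nonneg _)
  calc ‖ω - r‖ ^ 2 * |α| = 16 * (√|α| / 4 * (√|α| / 4 * ‖ω - r‖ ^ 2)) := by
        linear_combination -‖ω - r‖ ^ 2 * hα'
    _ ≤ 16 * (‖ω - r₁‖ * (‖ω - r₂‖ * ‖Q.eval ω‖)) := by
        gcongr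
        · exact key r₁ h₁
        · exact key r₂ h₂
    _ = _ := by rw [hp]

/-- As `|α| → ∞`, two roots of `p_{(α,β)}` tend to the roots of `q` and the other two to `∞`. -/
theorem mem_limitRoots_iff {l : Filter ℝ} [l.NeBot] (hl : Tendsto (fun α : ℝ => |α|) l atTop)
    {z : OnePoint ℂ} :
    z ∈ limitRoots c d l β ↔ z = OnePoint.infty ∨ ∃ ω : ℂ, q c d ω = 0 ∧ (ω : OnePoint ℂ) = z := by
  have hinv : Tendsto (fun α : ℝ => (α : ℂ)⁻¹) l (𝓝 0) := by
    rw [tendsto_zero_iff_norm_tendsto_zero]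
    simpa [Function.comp_def] using tendsto_inv_atTop_zero.comp hl
  constructor
  · rintro ⟨r, hr, hrz⟩
    induction z using OnePoint.rec with
    | infty => exact Or.inl rfl
    | coe ω =>
      refine Or.inr ⟨ω, ?_, rfl⟩
      have hrω : Tendsto r l (𝓝 ω) := OnePoint.isOpenEmbedding_coe.tendsto_nhds_iff.2 hrz
      have hq : Tendsto (fun α => q c d (r α)) l (𝓝 (q c d ω)) := by
        unfold q
        exact ((by fun_prop : Continuous fun z : ℂ =>
          (c : ℂ) - Complex.I * (d : ℂ) * z - z ^ 2).tendsto ω).comp hrω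
      have h0 : Tendsto (fun α : ℝ => (α : ℂ)⁻¹ * (r α ^ 2 * (q c d (r α) + β))) l (𝓝 0) := by
        simpa using hinv.mul ((hrω.pow 2).mul (hq.add_const (β : ℂ)))
      refine tendsto_nhds_unique hq (h0.congr' ?_)
      filter_upwards [hr, hl.eventually_gt_atTop 0] with α hα hα0
      have : (α : ℂ) ≠ 0 := by exact_mod_cast abs_pos.1 hα0
      rw [p_eq] at hα
      field_simp
      linear_combination -hα
  · rintro (rfl | ⟨ω, hω, rfl⟩)
    · have : ∀ α : ℝ, ∃ r : ℂ, 16 * |β| ≤ |α| → α ≠ 0 →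
          p c d α β r = 0 ∧ |α| ≤ (2 * ‖r‖) ^ 2 := by
        intro α
        by_cases h : 16 * |β| ≤ |α| ∧ α ≠ 0
        · obtain ⟨r₁, r₂, Q, -, -, hf, h₁, -⟩ := exists_two_large_roots c d h.1 h.2
          exact ⟨r₁, fun _ _ => ⟨by rw [hf]; simp, h₁⟩⟩
        · exact ⟨0, fun h1 h2 => absurd ⟨h1, h2⟩ h⟩
      choose r hr using this
      have hev : ∀ᶠ α in l, p c d α β (r α) = 0 ∧ |α| ≤ (2 * ‖r α‖) ^ 2 := by
        filter_upwards [hl.eventually_ge_atTop (16 * |β|), hl.eventually_gt_atTop 0] with α h1 h2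
        exact hr α h1 (abs_pos.1 h2)
      refine ⟨r, hev.mono fun _ h => h.1, ?_⟩
      refine OnePoint.tendsto_coe_infty.comp ?_
      rw [coclosedCompact_eq_cocompact, ← Metric.cobounded_eq_cocompact,
        ← tendsto_norm_atTop_iff_cobounded]
      refine tendsto_atTop.2 fun b => ?_
      filter_upwards [hev, hl.eventually_ge_atTop ((2 * max b 0) ^ 2)] with α h1 h2
      have := (sq_le_sq₀ (by positivity) (by positivity)).1 (h2.trans h1.2)
      exact (le_max_left b 0).trans (by linarith)
    · have : ∀ α : ℝ, ∃ r : ℂ, 16 * |β| ≤ |α| → (4 * ‖ω‖) ^ 2 ≤ |α| → α ≠ 0 →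
          p c d α β r = 0 ∧ ‖ω - r‖ ^ 2 * |α| ≤ 16 * (|β| * ‖ω‖ ^ 2) := by
        intro α
        by_cases h : 16 * |β| ≤ |α| ∧ (4 * ‖ω‖) ^ 2 ≤ |α| ∧ α ≠ 0
        · obtain ⟨r, hr⟩ := exists_root_norm_sub_sq_mul_le hω h.1 h.2.1 h.2.2
          exact ⟨r, fun _ _ _ => hr⟩
        · exact ⟨0, fun h1 h2 h3 => absurd ⟨h1, h2, h3⟩ h⟩
      choose r hr using this
      have hev : ∀ᶠ α in l, 0 < |α| ∧ p c d α β (r α) = 0 ∧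
          ‖ω - r α‖ ^ 2 * |α| ≤ 16 * (|β| * ‖ω‖ ^ 2) := by
        filter_upwards [hl.eventually_ge_atTop (16 * |β|), hl.eventually_gt_atTop 0,
          hl.eventually_ge_atTop ((4 * ‖ω‖) ^ 2)] with α h1 h2 h3
        exact ⟨h2, hr α h1 h3 (abs_pos.1 h2)⟩
      refine ⟨r, hev.mono fun _ h => h.2.1, ?_⟩
      refine (OnePoint.continuous_coe.tendsto ω).comp ?_
      have hsq : Tendsto (fun α => ‖ω - r α‖ ^ 2) l (𝓝 0) := by
        have h0 : Tendsto (fun α : ℝ => 16 * (|β| * ‖ω‖ ^ 2) / |α|) l (𝓝 0) :=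
          tendsto_const_nhds.div_atTop hl
        refine tendsto_of_tendsto_of_tendsto_of_le_of_le' tendsto_const_nhds h0
          (Eventually.of_forall fun α => by positivity) ?_
        filter_upwards [hev] with α h
        exact (le_div_iff₀ h.1).2 h.2.2
      have h1 : Tendsto (fun α => ‖ω - r α‖) l (𝓝 0) := by
        simpa [Real.sqrt_sq] using hsq.sqrt
      rw [tendsto_iff_norm_sub_tendsto_zero]
      simpa [norm_sub_rev] using h1

theorem mem_rootSet_coe {z : OnePoint ℂ} :
    z ∈ rootSet c d (α : EReal) β ↔ ∃ ω : ℂ, p c d α β ω = 0 ∧ (ω : OnePoint ℂ) = z := Iff.rfl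

theorem coe_mem_rootSet_coe :
    (ω : OnePoint ℂ) ∈ rootSet c d (α : EReal) β ↔ p c d α β ω = 0 := by
  simp [mem_rootSet_coe]

theorem mem_rootSet_of_ne_coe {a : EReal} (ha : a = ⊤ ∨ a = ⊥) {z : OnePoint ℂ} :
    z ∈ rootSet c d a β ↔
      z = OnePoint.infty ∨ ∃ ω : ℂ, q c d ω = 0 ∧ (ω : OnePoint ℂ) = z := by
  rcases ha with rfl | rfl
  · exact mem_limitRoots_iff tendsto_abs_atTop_atTop
  · exact mem_limitRoots_iff tendsto_abs_atBot_atTop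

theorem coe_mem_rootSet_of_ne_coe {a : EReal} (ha : a = ⊤ ∨ a = ⊥) :
    (ω : OnePoint ℂ) ∈ rootSet c d a β ↔ q c d ω = 0 := by
  simp [mem_rootSet_of_ne_coe ha]

/-! ### The real linear system for `(α, β)` given by a root -/

/-- Off the imaginary axis, the vanishing of this real number describes the points `ω` at which the
real and imaginary parts of `p_{(α,β)}(ω) = 0` fail to be independent linear equations
for `(α, β)`. For `c > 0` its zero set is a circle through `0`, and for `c = 0` the point `0`. -/
def discr (c d : ℝ) (ω : ℂ) : ℝ := 2 * c * ω.im + d * (ω.re ^ 2 + ω.im ^ 2)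

theorem continuous_discr (c d : ℝ) : Continuous (discr c d) := by
  unfold discr; fun_prop

theorem q_re (c d : ℝ) (ω : ℂ) : (q c d ω).re = c + d * ω.im - ω.re ^ 2 + ω.im ^ 2 := by
  simp [q, pow_two]; ring

theorem q_im (c d : ℝ) (ω : ℂ) : (q c d ω).im = -(d * ω.re) - 2 * ω.re * ω.im := by
  simp [q, pow_two]; ring

theorem p_re (c d α β : ℝ) (ω : ℂ) : (p c d α β ω).re =
    (α - (ω.re ^ 2 - ω.im ^ 2)) * (q c d ω).re + 2 * ω.re * ω.im * (q c d ω).im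
      - β * (ω.re ^ 2 - ω.im ^ 2) := by
  simp [p_eq, pow_two]; ring

theorem p_im (c d α β : ℝ) (ω : ℂ) : (p c d α β ω).im =
    (α - (ω.re ^ 2 - ω.im ^ 2)) * (q c d ω).im - 2 * ω.re * ω.im * (q c d ω).re
      - 2 * β * ω.re * ω.im := by
  simp [p_eq, pow_two]; ring

theorem discr_mul_of_p_eq_zero (hω : ω.re ≠ 0) (h : p c d α β ω = 0) :
    discr c d ω * α = (d + 2 * ω.im) * (ω.re ^ 2 + ω.im ^ 2) ^ 2 ∧
      discr c d ω * β = -2 * ω.im * ((q c d ω).re ^ 2 + (q c d ω).im ^ 2) := by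
  have h1 := congrArg Complex.re h
  have h2 := congrArg Complex.im h
  rw [p_re] at h1
  rw [p_im] at h2
  simp only [Complex.zero_re, Complex.zero_im] at h1 h2
  constructor
  -- the imaginary part of `p * conj (ω ^ 2)` does not contain `β`
  · refine mul_left_cancel₀ hω ?_
    rw [q_re, q_im] at h1 h2
    unfold discr
    linear_combination 2 * ω.re * ω.im * h1 - (ω.re ^ 2 - ω.im ^ 2) * h2
  -- the imaginary part of `p * conj q` does not contain `α`
  · refine mul_left_cancel₀ hω ?_
    unfold discr
    rw [q_re, q_im] at *
    linear_combination (-(d * ω.re) - 2 * ω.re * ω.im) * h1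
      - (c + d * ω.im - ω.re ^ 2 + ω.im ^ 2) * h2

theorem p_eq_zero_of_discr_mul (hD : discr c d ω ≠ 0)
    (h1 : discr c d ω * α = (d + 2 * ω.im) * (ω.re ^ 2 + ω.im ^ 2) ^ 2)
    (h2 : discr c d ω * β = -2 * ω.im * ((q c d ω).re ^ 2 + (q c d ω).im ^ 2)) :
    p c d α β ω = 0 := by
  apply Complex.ext
  · refine mul_left_cancel₀ hD ?_
    rw [p_re]
    rw [q_re, q_im] at *
    simp only [Complex.zero_re]
    unfold discr at *
    linear_combination (c + d * ω.im - ω.re ^ 2 + ω.im ^ 2) * h1 - (ω.re ^ 2 - ω.im ^ 2) * h2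
  · refine mul_left_cancel₀ hD ?_
    rw [p_im]
    rw [q_re, q_im] at *
    simp only [Complex.zero_im]
    unfold discr at *
    linear_combination (-(d * ω.re) - 2 * ω.re * ω.im) * h1 - 2 * ω.re * ω.im * h2

theorem q_eq_zero_of_discr_eq_zero (hd : 0 < d) (hω : ω.re ≠ 0) (h : p c d α β ω = 0)
    (hD : discr c d ω = 0) : q c d ω = 0 := by
  have h2 := (discr_mul_of_p_eq_zero hω h).2
  rw [hD, zero_mul, eq_comm, mul_eq_zero] at h2
  rcases h2 with h2 | h2
  · have hy : ω.im = 0 := by linarith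
    have : d * ω.re ^ 2 = 0 := by simpa [discr, hy] using hD
    simp [hd.ne', hω] at this
  · apply Complex.ext <;> simp only [Complex.zero_re, Complex.zero_im] <;> nlinarith

theorem discr_eq_zero_of_q_eq_zero (hω : ω.re ≠ 0) (h : q c d ω = 0) : discr c d ω = 0 := by
  have h1 := congrArg Complex.re h
  have h2 := congrArg Complex.im h
  rw [q_re] at h1
  rw [q_im] at h2
  simp only [Complex.zero_re, Complex.zero_im] at h1 h2
  refine mul_left_cancel₀ hω ?_
  unfold discr
  linear_combination 2 * ω.re * ω.im * h1 - (ω.re ^ 2 - ω.im ^ 2) * h2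

/-! ### Closedness of `W_Ω(T)` -/

theorem norm_le_of_p_eq_zero {R M : ℝ} (hc : 0 ≤ c) (hd : 0 < d) (hα : |α| ≤ R) (hβ : |β| ≤ M)
    (h : p c d α β ω = 0) : ‖ω‖ ≤ 1 + d + (R + c + M) + d * R + R * c := by
  have hR : 0 ≤ R := (abs_nonneg _).trans hα
  have hM : 0 ≤ M := (abs_nonneg _).trans hβ
  rcases le_total ‖ω‖ 1 with h1 | h1
  · have : 0 ≤ d * R := by positivity
    have : 0 ≤ R * c := by positivity
    linarith
  have h4 : ω ^ 4 = -(Complex.I * d * ω ^ 3) + (α + c + β : ℝ) * ω ^ 2 + Complex.I * d * α * ω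
      + -((α * c : ℝ) : ℂ) := by
    unfold p at h
    push_cast
    linear_combination h
  have h5 : ‖ω‖ ^ 4 ≤ d * ‖ω‖ ^ 3 + (R + c + M) * ‖ω‖ ^ 2 + d * R * ‖ω‖ + R * c := by
    rw [← norm_pow, h4]
    refine (norm_add_le _ _).trans (add_le_add ((norm_add_le _ _).trans (add_le_add
      ((norm_add_le _ _).trans (add_le_add ?_ ?_)) ?_)) ?_)
    · simp [abs_of_pos hd]
    · rw [norm_mul, norm_pow, Complex.norm_real, Real.norm_eq_abs]
      gcongr
      refine (abs_add_three _ _ _).trans ?_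
      rw [abs_of_nonneg hc]
      gcongr
    · simp only [norm_mul, Complex.norm_I, Complex.norm_real, Real.norm_eq_abs, abs_of_pos hd,
        one_mul]
      gcongr
    · rw [norm_neg, Complex.norm_real, Real.norm_eq_abs, abs_mul, abs_of_nonneg hc]
      gcongr
  have e2 : ‖ω‖ ^ 2 ≤ ‖ω‖ ^ 3 := pow_le_pow_right₀ h1 (by norm_num)
  have e1 : ‖ω‖ ≤ ‖ω‖ ^ 3 := le_self_pow₀ h1 (by norm_num)
  have e0 : 1 ≤ ‖ω‖ ^ 3 := one_le_pow₀ h1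
  have h6 : ‖ω‖ ^ 3 * ‖ω‖ ≤ ‖ω‖ ^ 3 * (d + (R + c + M) + d * R + R * c) := by
    have f2 := mul_le_mul_of_nonneg_left e2 (by positivity : 0 ≤ R + c + M)
    have f1 := mul_le_mul_of_nonneg_left e1 (by positivity : 0 ≤ d * R)
    have f0 := mul_le_mul_of_nonneg_left e0 (by positivity : 0 ≤ R * c)
    linarith
  have := le_of_mul_le_mul_left h6 (by positivity)
  linarith

theorem tendsto_inv_toReal {a : EReal} (ha : a = ⊤ ∨ a = ⊥) :
    Tendsto (fun a : EReal => a.toReal⁻¹) (𝓝 a) (𝓝 0) := by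
  rw [← nhdsNE_sup_pure, tendsto_sup]
  rcases ha with rfl | rfl
  · exact ⟨tendsto_inv_atTop_zero.comp EReal.tendsto_toReal_atTop, by
      rw [tendsto_pure_left]; intro s hs; simpa using mem_of_mem_nhds hs⟩
  · exact ⟨tendsto_inv_atBot_zero.comp EReal.tendsto_toReal_atBot, by
      rw [tendsto_pure_left]; intro s hs; simpa using mem_of_mem_nhds hs⟩

theorem eq_coe_or (a : EReal) : (∃ α : ℝ, a = α) ∨ a = ⊤ ∨ a = ⊥ := by
  induction a <;> simp

theorem continuous_q (c d : ℝ) : Continuous (q c d) := by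
  unfold q; fun_prop

/-- Roots in the Riemann sphere depend on `(α, β)` with closed graph, including at `α = ±∞`. -/
theorem isClosed_graph_rootSet (hc : 0 ≤ c) (hd : 0 < d) :
    IsClosed {x : (EReal × ℝ) × OnePoint ℂ | x.2 ∈ rootSet c d x.1.1 x.1.2} := by
  refine isClosed_iff_ultrafilter.2 ?_
  rintro ⟨⟨a, β⟩, z⟩ u hu hS
  have ha : Tendsto (fun x : (EReal × ℝ) × OnePoint ℂ => x.1.1) u (𝓝 a) :=
    ((by fun_prop : Continuous fun x : (EReal × ℝ) × OnePoint ℂ => x.1.1).tendsto _).mono_left hu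
  have hb : Tendsto (fun x : (EReal × ℝ) × OnePoint ℂ => x.1.2) u (𝓝 β) :=
    ((by fun_prop : Continuous fun x : (EReal × ℝ) × OnePoint ℂ => x.1.2).tendsto _).mono_left hu
  have hz : Tendsto (fun x : (EReal × ℝ) × OnePoint ℂ => x.2) u (𝓝 z) :=
    (continuous_snd.tendsto _).mono_left hu
  change ∀ᶠ x : (EReal × ℝ) × OnePoint ℂ in u, x.2 ∈ rootSet c d x.1.1 x.1.2 at hS
  change z ∈ rootSet c d a β
  -- the finite part of a point of the sphere, with value `0` at `∞`
  set f : OnePoint ℂ → ℂ := fun z => z.elim 0 id with hf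
  have hfin : ∀ w : ℂ, z = w → Tendsto (fun x : (EReal × ℝ) × OnePoint ℂ => f x.2) u (𝓝 w) ∧
      ∀ᶠ x : (EReal × ℝ) × OnePoint ℂ in u, (f x.2 : OnePoint ℂ) = x.2 := by
    rintro w rfl
    constructor
    · have : ContinuousAt f (w : OnePoint ℂ) := OnePoint.continuousAt_coe.2 continuousAt_id
      exact this.tendsto.comp hz
    · have := hz.eventually (OnePoint.isOpenEmbedding_coe.isOpen_range.mem_nhds ⟨w, rfl⟩)
      filter_upwards [this] with x hx
      obtain ⟨v, hv⟩ := hx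
      rw [← hv]; rfl
  rcases eq_coe_or a with ⟨α, rfl⟩ | hinf
  · have har : Tendsto (fun x : (EReal × ℝ) × OnePoint ℂ => x.1.1.toReal) u (𝓝 α) :=
      (EReal.tendsto_toReal (EReal.coe_ne_top α) (EReal.coe_ne_bot α)).comp ha
    have hev : ∀ᶠ x : (EReal × ℝ) × OnePoint ℂ in u, ((x.1.1.toReal : ℝ) : EReal) = x.1.1 := by
      filter_upwards [ha.eventually (EReal.isOpenEmbedding_coe.isOpen_range.mem_nhds ⟨α, rfl⟩)]
        with x hx
      obtain ⟨v, hv⟩ := hx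
      rw [← hv]; rfl
    induction z using OnePoint.rec with
    | infty =>
      exfalso
      set C := 1 + d + ((|α| + 1) + c + (|β| + 1)) + d * (|α| + 1) + (|α| + 1) * c
      have hout : ∀ᶠ x : (EReal × ℝ) × OnePoint ℂ in u,
          x.2 ∉ ((↑) : ℂ → OnePoint ℂ) '' Metric.closedBall 0 C :=
        hz.eventually ((OnePoint.isOpen_compl_image_coe.2 ⟨Metric.isClosed_closedBall,
          isCompact_closedBall 0 C⟩).mem_nhds (by simp))
      have hα' := har.abs.eventually_lt_const (lt_add_one |α|)
      have hβ' := hb.abs.eventually_lt_const (lt_add_one |β|)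
      obtain ⟨x, h1, h2, h3, h4, h5⟩ := (hout.and (hα'.and (hβ'.and (hev.and hS)))).exists
      rw [← h4, mem_rootSet_coe] at h5
      obtain ⟨w, hw, hw'⟩ := h5
      refine h1 ⟨w, ?_, hw'⟩
      simpa using norm_le_of_p_eq_zero hc hd h2.le h3.le hw
    | coe w =>
      rw [coe_mem_rootSet_coe]
      obtain ⟨h1, h2⟩ := hfin w rfl
      have hp : Continuous fun y : (ℝ × ℝ) × ℂ => p c d y.1.1 y.1.2 y.2 := by unfold p; fun_prop
      have hlim := (hp.tendsto ((α, β), w)).comp ((har.prodMk_nhds hb).prodMk_nhds h1)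
      refine tendsto_nhds_unique hlim (tendsto_const_nhds.congr' ?_)
      filter_upwards [hev, hS, h2] with x e1 e2 e3
      rw [← e1, ← e3, coe_mem_rootSet_coe] at e2
      exact e2.symm
  · rw [mem_rootSet_of_ne_coe hinf]
    induction z using OnePoint.rec with
    | infty => exact Or.inl rfl
    | coe w =>
      refine Or.inr ⟨w, ?_, rfl⟩
      obtain ⟨h1, h2⟩ := hfin w rfl
      have hq := ((continuous_q c d).tendsto w).comp h1
      have hinv : Tendsto (fun x : (EReal × ℝ) × OnePoint ℂ => ((x.1.1.toReal⁻¹ : ℝ) : ℂ)) u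
          (𝓝 0) := by
        have := (Complex.continuous_ofReal.tendsto 0).comp ((tendsto_inv_toReal hinf).comp ha)
        simpa [Function.comp_def] using this
      have hne : ∀ᶠ x : (EReal × ℝ) × OnePoint ℂ in u, x.1.1 ≠ 0 :=
        ha.eventually_ne (by rcases hinf with rfl | rfl <;> simp)
      have h0 : Tendsto (fun x : (EReal × ℝ) × OnePoint ℂ => ((x.1.1.toReal⁻¹ : ℝ) : ℂ) *
          (f x.2 ^ 2 * (q c d (f x.2) + (x.1.2 : ℂ)))) u (𝓝 0) := by
        have := hinv.mul ((h1.pow 2).mul (hq.add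
          ((Complex.continuous_ofReal.tendsto β).comp hb)))
        simpa [Function.comp_def] using this
      refine tendsto_nhds_unique hq (h0.congr' ?_)
      filter_upwards [hS, h2, hne] with x e1 e2 e3
      rw [← e2] at e1
      rcases eq_coe_or x.1.1 with ⟨α, hα⟩ | hx
      · rw [hα] at e1 e3 ⊢
        rw [coe_mem_rootSet_coe, p_eq] at e1
        have : (α : ℂ) ≠ 0 := by
          intro h; exact e3 (by rw [Complex.ofReal_eq_zero.1 h]; rfl)
        simp only [Function.comp, EReal.toReal_coe, Complex.ofReal_inv]
        field_simp
        linear_combination -e1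
      · rw [coe_mem_rootSet_of_ne_coe hx] at e1
        rcases hx with hx | hx <;> simp [hx, e1]

theorem mem_W {X : Set (EReal × ℝ)} {z : OnePoint ℂ} :
    z ∈ W c d X ↔ ∃ x ∈ X, z ∈ rootSet c d x.1 x.2 := by
  simp [W]

theorem W_mono {X Y : Set (EReal × ℝ)} (h : X ⊆ Y) : W c d X ⊆ W c d Y :=
  Set.biUnion_subset_biUnion_left h

theorem isClosed_W (hc : 0 ≤ c) (hd : 0 < d) {Ω : Set (EReal × ℝ)} (hΩ : IsClosed Ω) {M : ℝ}
    (hM : ∀ x ∈ Ω, |x.2| ≤ M) : IsClosed (W c d Ω) := by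
  have hcomp : IsCompact Ω := by
    refine (isCompact_univ.prod (isCompact_Icc (a := -M) (b := M))).of_isClosed_subset hΩ ?_
    exact fun x hx => ⟨trivial, abs_le.1 (hM x hx)⟩
  have hK := (hcomp.prod (isCompact_univ (X := OnePoint ℂ))).inter_right
    (isClosed_graph_rootSet hc hd)
  convert (hK.image continuous_snd).isClosed using 1
  ext z
  simp only [mem_W, Set.mem_image, Set.mem_inter_iff, Set.mem_prod, Set.mem_univ, and_true,
    Set.mem_ofPred_eq]
  constructor
  · rintro ⟨x, hx, hz⟩
    exact ⟨(x, z), ⟨hx, hz⟩, rfl⟩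
  · rintro ⟨⟨x, z⟩, ⟨hx, hz⟩, rfl⟩
    exact ⟨x, hx, hz⟩

/-! ### Curves that meet the boundary of `Ω` -/

theorem exists_mem_frontier {X : Type*} [TopologicalSpace X] {S : Set X} {f : ℝ → X}
    (hf : Continuous f) {s t : ℝ} (hs : f s ∈ S) (ht : f t ∉ S) : ∃ u, f u ∈ frontier S := by
  have : (frontier (f ⁻¹' S)).Nonempty :=
    nonempty_frontier_iff.2 ⟨⟨s, hs⟩, fun h => ht (h ▸ Set.mem_univ t : t ∈ f ⁻¹' S)⟩
  obtain ⟨u, hu⟩ := this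
  exact ⟨u, hf.frontier_preimage_subset S hu⟩

/-- The graph of a continuous function of `β` leaves `Ω`, which is bounded in `β`, and so crosses
its boundary. -/
theorem exists_snd_mem_frontier {Ω : Set (EReal × ℝ)} {M : ℝ} (hM : ∀ x ∈ Ω, |x.2| ≤ M)
    {g : ℝ → EReal} (hg : Continuous g) (h : (g β, β) ∈ Ω) : ∃ b, (g b, b) ∈ frontier Ω := by
  refine exists_mem_frontier (f := fun b => (g b, b)) (by fun_prop) h (t := |M| + 1) fun h' => ?_
  have := hM _ h'
  rw [abs_of_nonneg (by positivity)] at this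
  linarith [le_abs_self M]

theorem mem_W_frontier_of_infinite {Ω : Set (EReal × ℝ)} {M : ℝ} (hM : ∀ x ∈ Ω, |x.2| ≤ M)
    {a : EReal} (ha : a = ⊤ ∨ a = ⊥) (h : (a, β) ∈ Ω) {z : OnePoint ℂ}
    (hz : z ∈ rootSet c d a β) : z ∈ W c d (frontier Ω) := by
  obtain ⟨b, hb⟩ := exists_snd_mem_frontier hM (continuous_const (y := a)) h
  rw [mem_W]
  exact ⟨_, hb, by rwa [mem_rootSet_of_ne_coe ha] at hz ⊢⟩

/-- If `q(ω) = 0`, then `p_{(α,β)}(ω) = -βω²` does not depend on `α`, and `α` can be moved to the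
boundary or to `+∞`. -/
theorem mem_W_frontier_of_q_eq_zero {Ω : Set (EReal × ℝ)} (hΩ : IsClosed Ω) {M : ℝ}
    (hM : ∀ x ∈ Ω, |x.2| ≤ M) (hq : q c d ω = 0) (h : (ω : OnePoint ℂ) ∈ W c d Ω) :
    (ω : OnePoint ℂ) ∈ W c d (frontier Ω) := by
  obtain ⟨⟨a, β⟩, hx, hz⟩ := mem_W.1 h
  rcases eq_coe_or a with ⟨α, rfl⟩ | ha
  · by_cases hall : ∀ t : ℝ, ((t : EReal), β) ∈ Ω
    · have htop : ((⊤ : EReal), β) ∈ Ω := by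
        have hlim : Tendsto (fun t : ℝ => ((t : EReal), β)) atTop (𝓝 (⊤, β)) :=
          EReal.tendsto_coe_atTop.prodMk_nhds tendsto_const_nhds
        exact hΩ.mem_of_tendsto hlim (Eventually.of_forall hall)
      exact mem_W_frontier_of_infinite hM (Or.inl rfl) htop
        ((coe_mem_rootSet_of_ne_coe (Or.inl rfl)).2 hq)
    · push Not at hall
      obtain ⟨t, ht⟩ := hall
      obtain ⟨u, hu⟩ := exists_mem_frontier (f := fun t : ℝ => ((t : EReal), β))
        (continuous_coe_real_ereal.prodMk continuous_const) hx ht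
      refine mem_W.2 ⟨_, hu, ?_⟩
      rw [coe_mem_rootSet_coe, p_eq, hq] at hz ⊢
      simpa using hz
  · exact mem_W_frontier_of_infinite hM ha hx hz

/-- A purely imaginary `ω` imposes a single real equation on `(α, β)`; following its solutions out
of the bounded range of `β`, one crosses the boundary of `Ω`. -/
theorem mem_W_frontier_of_re_eq_zero {Ω : Set (EReal × ℝ)} (hΩ : IsClosed Ω) {M : ℝ}
    (hM : ∀ x ∈ Ω, |x.2| ≤ M) (hre : ω.re = 0) (h : (ω : OnePoint ℂ) ∈ W c d Ω) :
    (ω : OnePoint ℂ) ∈ W c d (frontier Ω) := by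
  by_cases hq : q c d ω = 0
  · exact mem_W_frontier_of_q_eq_zero hΩ hM hq h
  obtain ⟨⟨a, β⟩, hx, hz⟩ := mem_W.1 h
  rcases eq_coe_or a with ⟨α, rfl⟩ | ha
  · set y := ω.im
    set k := (q c d ω).re with hk
    have hk0 : k ≠ 0 := by
      intro h0
      exact hq (Complex.ext h0 (by rw [q_im, hre]; simp))
    have hpk : ∀ α β : ℝ, p c d α β ω = 0 ↔ α = -y ^ 2 - β * y ^ 2 / k := by
      intro α β
      have him : (p c d α β ω).im = 0 := by rw [p_im, q_im, hre]; simp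
      have hr : (p c d α β ω).re = (α + y ^ 2) * k + β * y ^ 2 := by
        rw [p_re, hre, ← hk]; ring
      constructor
      · intro h0
        rw [h0, Complex.zero_re] at hr
        field_simp
        linear_combination -hr
      · intro h0
        refine Complex.ext ?_ him
        rw [hr, h0, Complex.zero_re]
        field_simp
        ring
    have hg : Continuous fun b : ℝ => ((-y ^ 2 - b * y ^ 2 / k : ℝ) : EReal) :=
      continuous_coe_real_ereal.comp (by fun_prop)
    rw [coe_mem_rootSet_coe, hpk] at hz
    rw [hz] at hx
    obtain ⟨b, hb⟩ := exists_snd_mem_frontier hM hg hx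
    refine mem_W.2 ⟨_, hb, ?_⟩
    rw [coe_mem_rootSet_coe, hpk]
  · exact mem_W_frontier_of_infinite hM ha hx hz

/-! ### Interior and boundary points of `W_Ω(T)` -/

variable {Ω : Set (EReal × ℝ)} {M : ℝ}

theorem coe_mem_W_iff : (ω : OnePoint ℂ) ∈ W c d Ω ↔
    (∃ α β : ℝ, ((α : EReal), β) ∈ Ω ∧ p c d α β ω = 0) ∨
      (∃ x ∈ Ω, (x.1 = ⊤ ∨ x.1 = ⊥) ∧ q c d ω = 0) := by
  rw [mem_W]
  constructor
  · rintro ⟨⟨a, β⟩, hx, hz⟩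
    rcases eq_coe_or a with ⟨α, rfl⟩ | ha
    · exact Or.inl ⟨α, β, hx, coe_mem_rootSet_coe.1 hz⟩
    · exact Or.inr ⟨_, hx, ha, (coe_mem_rootSet_of_ne_coe ha).1 hz⟩
  · rintro (⟨α, β, hx, hp⟩ | ⟨x, hx, ha, hq⟩)
    · exact ⟨_, hx, coe_mem_rootSet_coe.2 hp⟩
    · exact ⟨x, hx, (coe_mem_rootSet_of_ne_coe ha).2 hq⟩

theorem infty_mem_W_iff : (OnePoint.infty : OnePoint ℂ) ∈ W c d Ω ↔
    ∃ x ∈ Ω, x.1 = ⊤ ∨ x.1 = ⊥ := by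
  rw [mem_W]
  constructor
  · rintro ⟨⟨a, β⟩, hx, hz⟩
    rcases eq_coe_or a with ⟨α, rfl⟩ | ha
    · obtain ⟨w, -, hw⟩ := mem_rootSet_coe.1 hz
      exact absurd hw (OnePoint.coe_ne_infty w)
    · exact ⟨_, hx, ha⟩
  · rintro ⟨x, hx, ha⟩
    exact ⟨x, hx, (mem_rootSet_of_ne_coe ha).2 (Or.inl rfl)⟩

theorem coe_notMem_W_of_discr_eq_zero (hd : 0 < d) (hω : ω.re ≠ 0) (hD : discr c d ω = 0)
    (hq : q c d ω ≠ 0) : (ω : OnePoint ℂ) ∉ W c d Ω := by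
  rw [coe_mem_W_iff]
  rintro (⟨α, β, -, hp⟩ | ⟨x, -, -, hq'⟩)
  · exact hq (q_eq_zero_of_discr_eq_zero hd hω hp hD)
  · exact hq hq'

theorem eventually_coe_mem_of_mem_interior {S : Set (OnePoint ℂ)}
    (h : (ω : OnePoint ℂ) ∈ interior S) : ∀ᶠ z : ℂ in 𝓝 ω, (z : OnePoint ℂ) ∈ S :=
  (OnePoint.continuous_coe.tendsto ω).eventually (mem_interior_iff_mem_nhds.1 h)

theorem mem_nhds_coe_prod_iff {S : Set (EReal × ℝ)} :
    S ∈ 𝓝 ((α : EReal), β) ↔ ∀ᶠ x : ℝ × ℝ in 𝓝 (α, β), ((x.1 : EReal), x.2) ∈ S := by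
  have := (EReal.isOpenEmbedding_coe.prodMap (IsOpenEmbedding.id (X := ℝ))).map_nhds_eq (α, β)
  simp only [Prod.map, id] at this
  rw [← this]
  rfl

/-- Off the circle `discr = 0`, `(α, β)` is a continuous function of the root `ω`, so a root of an
interior pair is an interior point. -/
theorem coe_mem_interior_W (hω : ω.re ≠ 0) (hD : discr c d ω ≠ 0) (hp : p c d α β ω = 0)
    (hx : ((α : EReal), β) ∈ interior Ω) : (ω : OnePoint ℂ) ∈ interior (W c d Ω) := by
  set F : ℂ → ℝ × ℝ := fun z =>
    ((d + 2 * z.im) * (z.re ^ 2 + z.im ^ 2) ^ 2 / discr c d z,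
      -2 * z.im * ((q c d z).re ^ 2 + (q c d z).im ^ 2) / discr c d z) with hF
  have hFω : F ω = (α, β) := by
    obtain ⟨h1, h2⟩ := discr_mul_of_p_eq_zero hω hp
    simp only [hF, ← h1, ← h2]
    field_simp
  have hcont : ContinuousAt F ω := by
    have h1 : Continuous fun z : ℂ => (q c d z).re := Complex.continuous_re.comp (continuous_q c d)
    have h2 : Continuous fun z : ℂ => (q c d z).im := Complex.continuous_im.comp (continuous_q c d)
    have h3 := (continuous_discr c d).continuousAt (x := ω)
    refine ContinuousAt.prodMk (ContinuousAt.div (by fun_prop) h3 hD)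
      (ContinuousAt.div (by fun_prop) h3 hD)
  have hlim : Tendsto F (𝓝 ω) (𝓝 (α, β)) := hFω ▸ hcont
  have hev := hlim.eventually (mem_nhds_coe_prod_iff.1 (mem_interior_iff_mem_nhds.1 hx))
  rw [mem_interior_iff_mem_nhds, OnePoint.nhds_coe_eq, mem_map]
  filter_upwards [hev, (continuous_discr c d).continuousAt.eventually_ne hD] with z hz hDz
  refine coe_mem_W_iff.2 (Or.inl ⟨_, _, hz, p_eq_zero_of_discr_mul hDz ?_ ?_⟩)
  · exact mul_div_cancel₀ _ hDz
  · exact mul_div_cancel₀ _ hDz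

/-- Off the circle `discr = 0`, the roots of a pair near `(α, β)` and outside `Ω` lie near `ω` and
outside `W_Ω(T)`. -/
theorem coe_notMem_interior_W (hω : ω.re ≠ 0) (hD : discr c d ω ≠ 0) (hp : p c d α β ω = 0)
    (hx : ((α : EReal), β) ∈ frontier Ω) : (ω : OnePoint ℂ) ∉ interior (W c d Ω) := by
  intro hint
  refine hx.2 (mem_interior_iff_mem_nhds.2 (mem_nhds_coe_prod_iff.2 ?_))
  have hN : ∀ᶠ z : ℂ in 𝓝 ω, (z : OnePoint ℂ) ∈ W c d Ω ∧ z.re ≠ 0 ∧ discr c d z ≠ 0 :=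
    (eventually_coe_mem_of_mem_interior hint).and
      ((Complex.continuous_re.continuousAt.eventually_ne hω).and
        ((continuous_discr c d).continuousAt.eventually_ne hD))
  filter_upwards [eventually_exists_root_mem hp hN] with x ⟨z, ⟨hz, hre, hDz⟩, hpz⟩
  rcases coe_mem_W_iff.1 hz with ⟨α', β', hx', hp'⟩ | ⟨-, -, -, hq⟩
  · obtain ⟨h1, h2⟩ := discr_mul_of_p_eq_zero hre hpz
    obtain ⟨h1', h2'⟩ := discr_mul_of_p_eq_zero hre hp'
    rw [mul_left_cancel₀ hDz (h1.trans h1'.symm), mul_left_cancel₀ hDz (h2.trans h2'.symm)]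
    exact hx'
  · exact absurd (discr_eq_zero_of_q_eq_zero hre hq) hDz

/-- A root of `q` off the imaginary axis lies on the circle `discr = 0`, whose other nearby points
are not in `W_Ω(T)`. -/
theorem coe_notMem_interior_W_of_q_eq_zero (hd : 0 < d) (hω : ω.re ≠ 0) (hq : q c d ω = 0) :
    (ω : OnePoint ℂ) ∉ interior (W c d Ω) := by
  intro hint
  have hD := discr_eq_zero_of_q_eq_zero hω hq
  -- the arc of the circle through `ω`, parametrized by the imaginary part
  set φ : ℝ → ℝ := fun t => (-(2 * c * t) / d - t ^ 2) / ω.re ^ 2 with hφ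
  set γ : ℝ → ℂ := fun t => ⟨ω.re * √(φ t), t⟩ with hγ
  have hφ1 : φ ω.im = 1 := by
    unfold discr at hD
    simp only [hφ]
    field_simp
    linear_combination -hD
  have hφc : Continuous φ := by simp only [hφ]; fun_prop
  have hγc : Continuous γ := by
    have : γ = fun t => (((ω.re * √(φ t) : ℝ) : ℂ) + (t : ℂ) * Complex.I) := by
      funext t; apply Complex.ext <;> simp [hγ]
    rw [this]; fun_prop
  have hγω : γ ω.im = ω := by
    apply Complex.ext <;> simp [hγ, hφ1]
  have hev : ∀ᶠ t in 𝓝[≠] ω.im, (γ t : OnePoint ℂ) ∈ W c d Ω ∧ 0 < φ t ∧ t ≠ ω.im := by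
    have h1 : Tendsto γ (𝓝 ω.im) (𝓝 ω) := by simpa [hγω] using hγc.tendsto ω.im
    have h2 := h1.eventually (eventually_coe_mem_of_mem_interior hint)
    have h3 : ∀ᶠ t in 𝓝 ω.im, 0 < φ t :=
      hφc.continuousAt.eventually_const_lt (by rw [hφ1]; norm_num)
    exact (h2.filter_mono nhdsWithin_le_nhds).and
      ((h3.filter_mono nhdsWithin_le_nhds).and self_mem_nhdsWithin)
  obtain ⟨t, ht, hpos, hne⟩ := hev.exists
  have hre : (γ t).re ≠ 0 := mul_ne_zero hω (Real.sqrt_pos.2 hpos).ne'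
  refine coe_notMem_W_of_discr_eq_zero hd hre ?_ ?_ ht
  · have : ω.re ^ 2 * φ t = -(2 * c * t) / d - t ^ 2 := by
      simp only [hφ]; field_simp
    simp only [discr, hγ, mul_pow, Real.sq_sqrt hpos.le, this]
    field_simp
    ring
  -- off the imaginary axis, the imaginary part of a root of `q` is `-d / 2`
  · intro hq'
    have key : ∀ z : ℂ, z.re ≠ 0 → q c d z = 0 → z.im = -d / 2 := by
      intro z hz h
      have h2 := congrArg Complex.im h
      rw [q_im, Complex.zero_im] at h2
      have := mul_left_cancel₀ hz (show z.re * (d + 2 * z.im) = z.re * 0 by linarith)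
      linarith
    exact hne ((key _ hre hq').trans (key _ hω hq).symm)

/-- On the ray `t (1 + i)`, membership in `W_Ω(T)` would force `β → -∞`. -/
theorem infty_notMem_interior_W (hc : 0 ≤ c) (hd : 0 < d) (hM : ∀ x ∈ Ω, |x.2| ≤ M) :
    (OnePoint.infty : OnePoint ℂ) ∉ interior (W c d Ω) := by
  intro hint
  set γ : ℝ → ℂ := fun t => ⟨t, t⟩
  have hlim : Tendsto (fun t => (γ t : OnePoint ℂ)) atTop (𝓝 OnePoint.infty) := by
    refine OnePoint.tendsto_coe_infty.comp ?_
    rw [coclosedCompact_eq_cocompact, ← Metric.cobounded_eq_cocompact,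
      ← tendsto_norm_atTop_iff_cobounded]
    exact tendsto_atTop_mono (fun t => (le_abs_self t).trans (Complex.abs_re_le_norm (γ t)))
      tendsto_id
  have hev := hlim.eventually (mem_interior_iff_mem_nhds.1 hint)
  obtain ⟨t, ht, ht1, htM⟩ := (hev.and ((eventually_ge_atTop 1).and
    (eventually_ge_atTop (M * (c + d) + 1)))).exists
  have ht0 : 0 < t := by linarith
  have hre : (γ t).re ≠ 0 := ht0.ne'
  have hD : discr c d (γ t) = 2 * t * (c + d * t) := by simp only [discr, γ]; ring
  have hDpos : 0 < discr c d (γ t) := by rw [hD]; positivity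
  rcases coe_mem_W_iff.1 ht with ⟨α, β, hx, hp⟩ | ⟨-, -, -, hq⟩
  · have h2 := (discr_mul_of_p_eq_zero hre hp).2
    rw [hD] at h2
    have hβ := (abs_le.1 (hM _ hx)).1
    simp only at hβ
    have him : (2 * t ^ 2) ^ 2 ≤ (q c d (γ t)).im ^ 2 := by
      rw [q_im]
      have e : (-(d * (γ t).re) - 2 * (γ t).re * (γ t).im) ^ 2 = (d * t + 2 * t ^ 2) ^ 2 := by
        simp only [γ]; ring
      rw [e]
      gcongr
      nlinarith
    have hle : 4 * t ^ 4 ≤ M * (c + d * t) := by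
      refine le_of_mul_le_mul_left (a := 2 * t) ?_ (by positivity)
      have hct : 0 ≤ 2 * t * (c + d * t) := by positivity
      have e1 : (γ t).im = t := rfl
      rw [e1] at h2
      nlinarith [mul_le_mul_of_nonneg_left hβ hct, sq_nonneg (q c d (γ t)).re,
        mul_nonneg ht0.le (sq_nonneg (q c d (γ t)).re),
        mul_le_mul_of_nonneg_left him (mul_nonneg zero_le_two ht0.le)]
    have hM0 : 0 ≤ M := (abs_nonneg _).trans (hM _ hx)
    have h3 : M * (c + d * t) ≤ M * (c + d) * t := by nlinarith [mul_nonneg hM0 hc]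
    have h4 : M * (c + d) * t ≤ t * t := by
      have : M * (c + d) ≤ t := by linarith
      gcongr
    nlinarith [pow_le_pow_right₀ ht1 (show 2 ≤ 4 by norm_num), pow_pos ht0 4]
  · exact hDpos.ne' (discr_eq_zero_of_q_eq_zero hre hq)

/-- The boundary correspondence for an arbitrary closed set `Ω` bounded in its second
coordinate. -/
theorem W_inter_imAxis_and_frontier_W_diff_imAxis (hc : 0 ≤ c) (hd : 0 < d) (hΩ : IsClosed Ω)
    (hM : ∀ x ∈ Ω, |x.2| ≤ M) :
    W c d Ω ∩ imAxis = W c d (frontier Ω) ∩ imAxis ∧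
      frontier (W c d Ω) \ imAxis = W c d (frontier Ω) \ imAxis := by
  have hsub : W c d (frontier Ω) ⊆ W c d Ω := W_mono hΩ.frontier_subset
  constructor
  · refine Set.Subset.antisymm ?_ (Set.inter_subset_inter_left _ hsub)
    rintro _ ⟨hz, ω, hω, rfl⟩
    exact ⟨mem_W_frontier_of_re_eq_zero hΩ hM hω hz, ω, hω, rfl⟩
  · ext z
    simp only [Set.mem_sdiff, and_congr_left_iff]
    intro hzi
    rw [(isClosed_W hc hd hΩ hM).frontier_eq]
    induction z using OnePoint.rec with
    | infty =>
      constructor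
      · rintro ⟨hz, -⟩
        obtain ⟨⟨a, β⟩, hx, ha⟩ := infty_mem_W_iff.1 hz
        exact mem_W_frontier_of_infinite hM ha hx ((mem_rootSet_of_ne_coe ha).2 (Or.inl rfl))
      · exact fun hz => ⟨hsub hz, infty_notMem_interior_W hc hd hM⟩
    | coe ω =>
      have hω : ω.re ≠ 0 := fun h => hzi ⟨ω, h, rfl⟩
      by_cases hq : q c d ω = 0
      · exact ⟨fun hz => mem_W_frontier_of_q_eq_zero hΩ hM hq hz.1,
          fun hz => ⟨hsub hz, coe_notMem_interior_W_of_q_eq_zero hd hω hq⟩⟩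
      have hD : ∀ {α β : ℝ}, p c d α β ω = 0 → discr c d ω ≠ 0 := fun hp hD =>
        hq (q_eq_zero_of_discr_eq_zero hd hω hp hD)
      constructor
      · rintro ⟨hz, hint⟩
        rcases coe_mem_W_iff.1 hz with ⟨α, β, hx, hp⟩ | ⟨-, -, -, hq'⟩
        · refine coe_mem_W_iff.2 (Or.inl ⟨α, β, ⟨subset_closure hx, fun hi => hint ?_⟩, hp⟩)
          exact coe_mem_interior_W hω (hD hp) hp hi
        · exact absurd hq' hq
      · intro hz
        refine ⟨hsub hz, ?_⟩
        rcases coe_mem_W_iff.1 hz with ⟨α, β, hx, hp⟩ | ⟨-, -, -, hq'⟩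
        · exact coe_notMem_interior_W hω (hD hp) hp hx
        · exact absurd hq' hq

theorem numRangeBdd_subset_Icc {H : Type*} [NormedAddCommGroup H] [InnerProductSpace ℂ H]
    (B : H →L[ℂ] H) : numRangeBdd B ⊆ Set.Icc (-‖B‖) ‖B‖ := by
  rintro b ⟨u, hu, hb⟩
  rw [Set.mem_Icc, ← abs_le, ← Real.norm_eq_abs, ← Complex.norm_real, ← hb, norm_div,
    inner_self_eq_norm_sq_to_K]
  have hu0 : 0 < ‖u‖ := norm_pos_iff.2 hu
  refine (div_le_iff₀ (by rw [norm_pow]; simpa using pow_pos hu0 2)).2 ?_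
  refine (norm_inner_le_norm u (B u)).trans ?_
  calc ‖u‖ * ‖B u‖ ≤ ‖u‖ * (‖B‖ * ‖u‖) := by gcongr; exact B.le_opNorm u
    _ = _ := by simp; ring

end RationalEnclosure

theorem theorem2p9 {H : Type*} [NormedAddCommGroup H] [InnerProductSpace ℂ H] [CompleteSpace H]
    (A : H →ₗ.[ℂ] H) (hA : IsSelfAdjoint A)
    (B : H →L[ℂ] H) (hB : IsSelfAdjoint B) (hB0 : B ≠ 0)
    (c d : ℝ) (hc : 0 ≤ c) (hd : 0 < d) :
    RationalEnclosure.W c d (RationalEnclosure.Omega A B) ∩ RationalEnclosure.imAxis =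
        RationalEnclosure.W c d (frontier (RationalEnclosure.Omega A B)) ∩
          RationalEnclosure.imAxis ∧
      frontier (RationalEnclosure.W c d (RationalEnclosure.Omega A B)) \
          RationalEnclosure.imAxis =
        RationalEnclosure.W c d (frontier (RationalEnclosure.Omega A B)) \
          RationalEnclosure.imAxis := by
  refine RationalEnclosure.W_inter_imAxis_and_frontier_W_diff_imAxis hc hd
    (isClosed_closure.prod isClosed_closure) (M := ‖B‖) ?_
  rintro ⟨a, b⟩ ⟨-, hb⟩
  exact abs_le.2 (closure_minimal (RationalEnclosure.numRangeBdd_subset_Icc B) isClosed_Icc hb)
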